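/- Let $p$ be a prime, let $G$ be a finite $p$-group, and let $E$ be a maximal normal elementary abelian subgroup of $G$, i.e. a subgroup maximal with respect to inclusion among the subgroups of $G$ that are both normal in $G$ and elementary abelian. For a finite group $H$ let $d(H)$ denote the minimal number of generators of $H$, and let $\Phi(H)$ denote its Frattini subgroup, i.e. the intersection of all maximal subgroups of $H$ (with $\Phi(1)=1$). Suppose that $d(E)=k$, and let $A$ be any abelian subgroup of $G$. Then (1) $d(\Phi(A))\le 2k$ if $p>2$; (2) $d(\Phi(A))\le 3k$ if $p=2$. -/

import Mathlib

/-- `H` is an elementary abelian `p`-subgroup: it is abelian and `x ^ p = 1` for all `x` in `H`.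
As usual, the trivial subgroup is elementary abelian (of rank `0`). -/
def Subgroup.IsElementaryAbelian {G : Type*} [Group G] (p : ℕ) (H : Subgroup G) : Prop :=
  IsMulCommutative H ∧ ∀ x ∈ H, x ^ p = 1

/-- `E` is a maximal normal elementary abelian subgroup of `G`: it is maximal, with respect to
inclusion, among the subgroups of `G` that are both normal in `G` and elementary abelian. -/
def Subgroup.IsMaximalNormalElementaryAbelian {G : Type*} [Group G] (p : ℕ) (E : Subgroup G) :
    Prop :=
  Maximal (fun H : Subgroup G => H.Normal ∧ H.IsElementaryAbelian p) E

/-! Let `T` be the subgroup of elements of `Φ(A)` killed by `p`. Since `Φ(A)` is an abelian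
`p`-group, `p ^ d(Φ(A)) ≤ |T|`, and since `Φ(A)` consists of `p`-th powers in `A`, so does `T`. It
remains to bound `|T : C_T(E)|` and `|C_T(E)|`.

The index counts automorphisms of `E` that are `p`-th powers of commuting operators on an
`F_p`-space of dimension `k`. Such powers span a space of dimension at most `k`
(`Module.End.card_le_finrank_of_linearIndependent_pow`), so the index is at most `p ^ k`.

For odd `p`, maximality of `E` forces `C_T(E) ≤ E` (`mem_of_two_lt`), giving `2k`. For `p = 2`,
counting solutions of `x ^ 2 = 1` in `C_G(E)` gives `|C_T(E)| ≤ |E| ^ 2`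
(`card_le_sq_of_le_centralizer`), hence `3k`. -/

/-! ### Linear algebra: `p`-th powers of commuting endomorphisms. -/

open Module in
theorem LinearMap.exists_generic_vector {K W V U : Type*} [Field K] [Infinite K]
    [AddCommGroup W] [Module K W] [AddCommGroup V] [Module K V] [AddCommGroup U] [Module K U]
    [FiniteDimensional K U] (B : W →ₗ[K] V →ₗ[K] U) :
    ∃ v, ∀ w, B w v = 0 → ∀ v', B w v' ∈ LinearMap.range (B.flip v) := by
  -- Take `v` for which `w ↦ B w v` has maximal rank; a counterexample `w`, `v'` will make the rank
  -- at `μ • v - v'` larger for suitable `μ`.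
  obtain ⟨v, hv⟩ : ∃ v, ∀ v', finrank K (LinearMap.range (B.flip v')) ≤
      finrank K (LinearMap.range (B.flip v)) := by
    have hbdd : BddAbove (Set.range fun v => finrank K (LinearMap.range (B.flip v))) :=
      ⟨finrank K U, by rintro _ ⟨v, rfl⟩; exact Submodule.finrank_le _⟩
    obtain ⟨v, hv⟩ := Nat.sSup_mem (Set.range_nonempty _) hbdd
    exact ⟨v, fun v' => (le_csSup hbdd ⟨v', rfl⟩).trans hv.ge⟩
  refine ⟨v, fun w hw v' => ?_⟩
  by_contra hu
  set R := LinearMap.range (B.flip v) with hR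
  set u := B w v' with hudef
  obtain ⟨f, hfu, hfR⟩ := Submodule.exists_le_ker_of_notMem hu
  obtain ⟨g, hg⟩ := (B.flip v).rangeRestrict.exists_rightInverse_of_surjective
    (LinearMap.range_rangeRestrict _)
  obtain ⟨π, hπ⟩ := R.subtype.exists_leftInverse_of_injective (Submodule.ker_subtype R)
  -- `q` retracts `U` onto `R` and kills `u`; hence `M` below kills `u` and sends `y ∈ R` to `B (g
  -- y) v'`.
  let q : U →ₗ[K] R := π ∘ₗ (LinearMap.id - ((f u)⁻¹ • f).smulRight u)
  have hqu : q u = 0 := by simp [q, hfu]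
  have hqR : ∀ y : R, q y = y := by
    intro y
    have h1 : f y = 0 := hfR y.2
    have h2 := LinearMap.congr_fun hπ y
    simpa [q, h1] using h2
  let M : U →ₗ[K] U := B.flip v' ∘ₗ g ∘ₗ q
  obtain ⟨μ, hμ⟩ : ∃ μ, μ ∉ (spectrum K M ∪ {0}) :=
    ((Module.End.finite_spectrum M).union (Set.finite_singleton 0)).exists_notMem
  simp only [Set.mem_union, Set.mem_singleton_iff, not_or] at hμ
  obtain ⟨hμ1, hμ0⟩ := hμ
  have hunit : IsUnit (algebraMap K (Module.End K U) μ - M) := spectrum.notMem_iff.mp hμ1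
  have hinj : Function.Injective (algebraMap K (Module.End K U) μ - M) :=
    ((Module.End.isUnit_iff _).mp hunit).injective
  set N : Module.End K U := algebraMap K (Module.End K U) μ - M with hN
  -- On `R`, `N y = B (g y) (μ • v - v')`; also `N u = μ • u = B (-(μ • w)) (μ • v - v')`. As `N` is
  -- injective, the rank grows.
  have hle : (R ⊔ K ∙ u).map N ≤ LinearMap.range (B.flip (μ • v - v')) := by
    rw [Submodule.map_sup, sup_le_iff]
    constructor
    · rintro _ ⟨y, hy, rfl⟩
      have h3 := LinearMap.congr_fun hg ⟨y, hy⟩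
      have h4 : B (g ⟨y, hy⟩) v = y := congrArg Subtype.val h3
      have h5 : q y = ⟨y, hy⟩ := hqR ⟨y, hy⟩
      refine ⟨g ⟨y, hy⟩, ?_⟩
      simp [hN, M, h5, h4]
    · rw [Submodule.map_span, Submodule.span_le]
      rintro _ ⟨_, rfl, rfl⟩
      refine ⟨-(μ • w), ?_⟩
      simp [hN, M, hqu, hw, ← hudef]
  have h6 := Submodule.finrank_mono hle
  rw [← (Submodule.equivMapOfInjective N hinj _).finrank_eq] at h6
  have h7 : R < R ⊔ K ∙ u := by
    refine lt_of_le_of_ne le_sup_left fun h => hu ?_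
    rw [h]
    exact (le_sup_right : K ∙ u ≤ _) (Submodule.mem_span_singleton_self u)
  have h8 := Submodule.finrank_lt_finrank_of_lt h7
  exact absurd (hv (μ • v - v')) (by omega)

-- For a generic `v`, dimension gives `c ≠ 0` with `B c v = 0`. Each `B c v'` then has the form `B
-- c' v`, and commutativity yields `(B c) ^ 2 v' = B c' (B c v) = 0`.
open Module in
theorem Module.End.exists_linear_combination_sq_eq_zero {K V ι : Type*} [Field K] [Infinite K]
    [AddCommGroup V] [Module K V] [FiniteDimensional K V] [Fintype ι]
    (r : ι → Module.End K V) (hr : ∀ i j, Commute (r i) (r j))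
    (h : finrank K V < Fintype.card ι) :
    ∃ c : ι → K, c ≠ 0 ∧ (∑ i, c i • r i) ^ 2 = 0 := by
  let B : (ι → K) →ₗ[K] Module.End K V := Fintype.linearCombination K r
  obtain ⟨v, hv⟩ := LinearMap.exists_generic_vector B
  have hB : ∀ c c', Commute (B c) (B c') := by
    intro c c'
    simp only [B, Fintype.linearCombination_apply]
    exact Commute.sum_left _ _ _ fun i _ => Commute.sum_right _ _ _ fun j _ =>
      ((hr i j).smul_left _).smul_right _
  have hker : LinearMap.ker (B.flip v) ≠ ⊥ :=
    LinearMap.ker_ne_bot_of_finrank_lt (by simpa using h)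
  obtain ⟨c, hc, hc0⟩ := Submodule.exists_mem_ne_zero_of_ne_bot hker
  refine ⟨c, hc0, ?_⟩
  change (B c) ^ 2 = 0
  ext v'
  obtain ⟨c', hc'⟩ := hv c hc v'
  have h1 : B c v = 0 := hc
  have h2 : B c' v = B c v' := hc'
  have h3 : B c (B c' v) = B c' (B c v) := LinearMap.congr_fun (hB c c').eq v
  rw [pow_two, Module.End.mul_apply, ← h2, h3, h1, map_zero, LinearMap.zero_apply]

theorem Finset.sum_pow_char_of_commute {R ι : Type*} [Ring R] (p : ℕ) [Fact p.Prime] [CharP R p]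
    (s : Finset ι) (f : ι → R) (hf : ∀ i j, Commute (f i) (f j)) :
    (∑ i ∈ s, f i) ^ p = ∑ i ∈ s, f i ^ p := by
  classical
  induction s using Finset.induction_on with
  | empty => simp [(Fact.out : p.Prime).ne_zero]
  | insert a s ha ih =>
    rw [Finset.sum_insert ha, Finset.sum_insert ha,
      add_pow_char_of_commute _ (Commute.sum_right _ _ _ fun j _ => hf a j), ih]

-- Over the algebraic closure, which is infinite, too many operators would have a nontrivial
-- combination of square zero. Its `p`-th power vanishes too, and by Frobenius this is a relation
-- among the `r i ^ p` with coefficients `c i ^ p`.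
open Module TensorProduct in
theorem Module.End.card_le_finrank_of_linearIndependent_pow {F V ι : Type*} [Field F] (p : ℕ)
    [Fact p.Prime] [CharP F p] [AddCommGroup V] [Module F V] [FiniteDimensional F V] [Fintype ι]
    (r : ι → Module.End F V) (hr : ∀ i j, Commute (r i) (r j))
    (hli : LinearIndependent F fun i => r i ^ p) :
    Fintype.card ι ≤ finrank F V := by
  by_contra! hlt
  let K := AlgebraicClosure F
  have : Infinite K := IsAlgClosed.instInfinite
  let r' : ι → Module.End K (K ⊗[F] V) := fun i => (r i).baseChange K
  have hr' : ∀ i j, Commute (r' i) (r' j) := by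
    intro i j
    change (r i).baseChange K * (r j).baseChange K = (r j).baseChange K * (r i).baseChange K
    rw [← LinearMap.baseChange_mul, ← LinearMap.baseChange_mul, (hr i j).eq]
  obtain ⟨c, hc0, hc⟩ := Module.End.exists_linear_combination_sq_eq_zero r' hr'
    (by rwa [Module.finrank_baseChange])
  obtain ⟨j, hj⟩ := Function.ne_iff.mp hc0
  have : Nontrivial V := by
    by_contra hV
    rw [not_nontrivial_iff_subsingleton] at hV
    exact hli.ne_zero j (Subsingleton.elim _ _)
  have : CharP K p := charP_of_injective_algebraMap (algebraMap F K).injective p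
  have : CharP (Module.End K (K ⊗[F] V)) p :=
    charP_of_injective_algebraMap (algebraMap K (Module.End K (K ⊗[F] V))).injective p
  have h1 : ∑ i, c i ^ p • (r i ^ p).baseChange K = 0 := by
    have h2 : (∑ i, c i • r' i) ^ p = 0 := pow_eq_zero_of_le (Fact.out : p.Prime).two_le hc
    rw [Finset.sum_pow_char_of_commute p Finset.univ (fun i => c i • r' i)
      fun i j => ((hr' i j).smul_left _).smul_right _] at h2
    simpa [smul_pow, r', LinearMap.baseChange_pow] using h2
  -- An `F`-linear functional on `K` carries the relation down to `F` and keeps the `j`-th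
  -- coefficient nonzero.
  obtain ⟨ℓ, hℓ⟩ : ∃ ℓ : Module.Dual F K, ℓ (c j ^ p) ≠ 0 := by
    by_contra! h
    exact pow_ne_zero p hj ((Module.forall_dual_apply_eq_zero_iff F _).mp h)
  refine hℓ (Fintype.linearIndependent_iff.mp hli (fun i => ℓ (c i ^ p)) ?_ j)
  ext v
  have h3 := LinearMap.congr_fun h1 (1 ⊗ₜ v)
  have h4 := congrArg (TensorProduct.lift ((LinearMap.lsmul F V).comp ℓ)) h3
  simpa [LinearMap.sum_apply, TensorProduct.smul_tmul'] using h4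

open Module in
theorem Module.End.card_pow_image_le {p : ℕ} [Fact p.Prime] {V : Type*} [AddCommGroup V]
    [Module (ZMod p) V] [Finite V] (S : Set (Module.End (ZMod p) V))
    (hS : ∀ x ∈ S, ∀ y ∈ S, Commute x y) :
    Nat.card ((fun x => x ^ p) '' S) ≤ Nat.card V := by
  have : Finite (Module.End (ZMod p) V) :=
    _root_.Finite.of_injective (fun f : Module.End (ZMod p) V => (f : V → V)) DFunLike.coe_injective
  -- The basis of the span is taken among the powers themselves, so its members have commuting
  -- `p`-th roots.
  obtain ⟨b, hb, hspan, hli⟩ := exists_linearIndependent (ZMod p) ((fun x => x ^ p) '' S)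
  have hb' : ∀ x : b, ∃ y ∈ S, y ^ p = x := fun x => hb x.2
  choose a haS ha using hb'
  have := Fintype.ofFinite b
  have hcard : Fintype.card b ≤ finrank (ZMod p) V := by
    refine Module.End.card_le_finrank_of_linearIndependent_pow p a
      (fun i j => hS _ (haS i) _ (haS j)) ?_
    simpa only [ha] using hli
  calc Nat.card ((fun x => x ^ p) '' S)
      ≤ Nat.card (Submodule.span (ZMod p) ((fun x => x ^ p) '' S)) :=
        Nat.card_mono (Set.toFinite _) Submodule.subset_span
    _ = p ^ finrank (ZMod p) (Submodule.span (ZMod p) b) := by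
        rw [hspan, Module.natCard_eq_pow_finrank (K := ZMod p), Nat.card_zmod]
    _ ≤ p ^ finrank (ZMod p) V := by
        rw [finrank_span_set_eq_card hli, Set.toFinset_card]
        exact Nat.pow_le_pow_right (Fact.out : p.Prime).pos hcard
    _ = Nat.card V := by
        rw [Module.natCard_eq_pow_finrank (K := ZMod p) (V := V), Nat.card_zmod]

/-! ### Coset counting, and ranks and Frattini subgroups of abelian `p`-groups. -/

theorem Subgroup.card_le_card_mul_card_of_fibers {T X : Type*} [Group T] [Finite T]
    (D : Subgroup T) (f : T → X) (S : Set X) [Finite S] (hS : ∀ t, f t ∈ S)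
    (h : ∀ s t, f s = f t → s⁻¹ * t ∈ D) : Nat.card T ≤ Nat.card S * Nat.card D := by
  have hr : ∀ t, f (Function.invFun f (f t)) = f t := fun t => Function.invFun_eq ⟨t, rfl⟩
  rw [← Nat.card_prod]
  refine Nat.card_le_card_of_injective (fun t => (⟨f t, hS t⟩,
    ⟨(Function.invFun f (f t))⁻¹ * t, h _ _ (hr t)⟩) : T → S × D) fun s t hst => ?_
  simp only [Prod.mk.injEq, Subtype.mk.injEq] at hst
  obtain ⟨h1, h2⟩ := hst
  rw [h1] at h2
  exact mul_left_cancel h2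

theorem IsPGroup.exists_finset_closure_eq_top {p : ℕ} (hp : p.Prime) {Q : Type*} [Group Q]
    [Finite Q] (hQ : IsPGroup p Q) :
    ∃ S : Finset Q, Subgroup.closure (S : Set Q) = ⊤ ∧ p ^ S.card ≤ Nat.card Q := by
  classical
  have : Fact p.Prime := ⟨hp⟩
  have := Fintype.ofFinite Q
  obtain ⟨S, hS⟩ := (Set.toFinite {S : Finset Q | p ^ S.card ≤
    Nat.card (Subgroup.closure (S : Set Q))}).exists_maximal ⟨∅, by simp⟩
  have hS1 : p ^ S.card ≤ Nat.card (Subgroup.closure (S : Set Q)) := hS.prop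
  refine ⟨S, ?_, hS1.trans (Subgroup.card_le_card_group _)⟩
  by_contra hne
  obtain ⟨x, hx⟩ : ∃ x, x ∉ Subgroup.closure (S : Set Q) := by
    by_contra! h
    exact hne ((Subgroup.eq_top_iff' _).mpr h)
  have hxS : x ∉ S := fun h => hx (Subgroup.subset_closure h)
  have hle : Subgroup.closure (S : Set Q) ≤ Subgroup.closure ((insert x S : Finset Q) : Set Q) :=
    Subgroup.closure_mono (by simp)
  have hlt : Subgroup.closure (S : Set Q) < Subgroup.closure ((insert x S : Finset Q) : Set Q) :=
    lt_of_le_of_ne hle fun h => hx (h ▸ Subgroup.subset_closure (by simp))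
  have hmem : p ^ (insert x S).card ≤
      Nat.card (Subgroup.closure ((insert x S : Finset Q) : Set Q)) := by
    obtain ⟨a, ha⟩ := IsPGroup.iff_card.mp (hQ.to_subgroup (Subgroup.closure (S : Set Q)))
    obtain ⟨b, hb⟩ := IsPGroup.iff_card.mp
      (hQ.to_subgroup (Subgroup.closure ((insert x S : Finset Q) : Set Q)))
    have hcard : Nat.card (Subgroup.closure (S : Set Q)) <
        Nat.card (Subgroup.closure ((insert x S : Finset Q) : Set Q)) :=
      lt_of_not_ge fun h => hlt.ne (Subgroup.eq_of_le_of_card_ge hle h)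
    rw [ha, hb, Nat.pow_lt_pow_iff_right hp.one_lt] at hcard
    rw [ha, Nat.pow_le_pow_iff_right hp.one_lt] at hS1
    rw [hb, Finset.card_insert_of_notMem hxS]
    exact Nat.pow_le_pow_right hp.pos (by omega)
  exact hxS (hS.le_of_ge hmem (Finset.subset_insert x S) (Finset.mem_insert_self x S))

/-- A Nakayama argument: iterating gives `B = H * B ^ (p ^ n)` for all `n`, and the second factor
dies when `p ^ n = |B|`. -/
theorem IsPGroup.eq_top_of_sup_range_pow_eq_top {p : ℕ} {B : Type*} [CommGroup B] [Finite B]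
    (hB : IsPGroup p B) [Fact p.Prime] {H : Subgroup B}
    (h : H ⊔ (powMonoidHom p : B →* B).range = ⊤) : H = ⊤ := by
  have key : ∀ n : ℕ, ∀ x : B, ∃ a ∈ H, ∃ y : B, a * y ^ p ^ n = x := by
    intro n
    induction n with
    | zero => exact fun x => ⟨1, H.one_mem, x, by simp⟩
    | succ n ih =>
      intro x
      obtain ⟨a, ha, y, rfl⟩ := ih x
      obtain ⟨b, hb, _, ⟨z, rfl⟩, rfl⟩ := Subgroup.mem_sup.mp (h ▸ Subgroup.mem_top y)
      refine ⟨a * b ^ p ^ n, H.mul_mem ha (H.pow_mem hb _), z, ?_⟩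
      rw [powMonoidHom_apply, mul_pow, ← pow_mul, mul_assoc, pow_succ' p n]
  obtain ⟨n, hn⟩ := IsPGroup.iff_card.mp hB
  refine (Subgroup.eq_top_iff' H).mpr fun x => ?_
  obtain ⟨a, ha, y, rfl⟩ := key n x
  rwa [← hn, pow_card_eq_one', mul_one]

/-- Generators of `B / B ^ p` lift to generators of `B`, and `|B / B ^ p|` equals the order of the
kernel of the power map. -/
theorem IsPGroup.pow_rank_le_card_ker_pow {p : ℕ} (hp : p.Prime) {B : Type*} [CommGroup B]
    [Finite B] (hB : IsPGroup p B) :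
    p ^ Group.rank B ≤ Nat.card (powMonoidHom p : B →* B).ker := by
  classical
  have : Fact p.Prime := ⟨hp⟩
  set R := (powMonoidHom p : B →* B).range with hR
  obtain ⟨S, hS, hcard⟩ := (hB.to_quotient R).exists_finset_closure_eq_top hp
  have htop : Subgroup.closure ((S.image Quotient.out : Finset B) : Set B) = ⊤ := by
    refine hB.eq_top_of_sup_range_pow_eq_top ?_
    have h1 : (Subgroup.closure ((S.image Quotient.out : Finset B) : Set B)).map
        (QuotientGroup.mk' R) = ⊤ := by
      rw [MonoidHom.map_closure, ← hS, Finset.coe_image, Set.image_image]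
      exact congrArg _ ((Set.image_congr fun x _ => QuotientGroup.out_eq' x).trans (Set.image_id _))
    have h2 := congrArg (Subgroup.comap (QuotientGroup.mk' R)) h1
    rwa [Subgroup.comap_map_eq, QuotientGroup.ker_mk', Subgroup.comap_top] at h2
  have hidx : Nat.card (B ⧸ R) = Nat.card (powMonoidHom p : B →* B).ker := by
    have h1 := Subgroup.card_mul_index (powMonoidHom p : B →* B).ker
    rw [Subgroup.index_ker, ← Subgroup.card_mul_index R, mul_comm] at h1
    exact (Nat.eq_of_mul_eq_mul_left Nat.card_pos h1).symm
  calc p ^ Group.rank B ≤ p ^ S.card :=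
        Nat.pow_le_pow_right hp.pos ((Group.rank_le htop).trans Finset.card_image_le)
    _ ≤ _ := hidx ▸ hcard

theorem frattini_le_range_pow {p : ℕ} (hp : p.Prime) {B : Type*} [CommGroup B] [Finite B] :
    frattini B ≤ (powMonoidHom p : B →* B).range := by
  intro a ha
  by_contra haR
  -- Such an `M` is a maximal subgroup: for `x ∉ M`, `a = m * x ^ i` with `p ∤ i`, so a larger `H`,
  -- containing `a` and `x ^ p`, contains `x`.
  obtain ⟨M, hM⟩ := (Set.toFinite {M : Subgroup B | (powMonoidHom p : B →* B).range ≤ M ∧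
    a ∉ M}).exists_maximal ⟨_, le_rfl, haR⟩
  have hRM : (powMonoidHom p : B →* B).range ≤ M := hM.prop.1
  have haM : a ∉ M := hM.prop.2
  have hmem : ∀ H, M < H → a ∈ H := by
    intro H hH
    by_contra haH
    exact hH.not_ge (hM.le_of_ge ⟨hRM.trans hH.le, haH⟩ hH.le)
  refine haM (frattini_le_coatom ⟨fun h => haM (by rw [h]; exact Subgroup.mem_top a), fun H hH => ?_⟩ ha)
  refine (Subgroup.eq_top_iff' H).mpr fun x => ?_
  by_cases hx : x ∈ M
  · exact hH.le hx
  have hlt : M < M ⊔ Subgroup.zpowers x := lt_of_le_of_ne le_sup_left fun h =>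
    hx (h ▸ Subgroup.mem_sup_right (Subgroup.mem_zpowers x))
  obtain ⟨m, hm, _, ⟨i, rfl⟩, hmi⟩ := Subgroup.mem_sup.mp (hmem _ hlt)
  have hxp : x ^ (p : ℤ) ∈ M := hRM ⟨x, by simp⟩
  have hi : ¬ (p : ℤ) ∣ i := by
    rintro ⟨j, rfl⟩
    refine haM (hmi ▸ M.mul_mem hm ?_)
    change x ^ ((p : ℤ) * j) ∈ M
    rw [zpow_mul]
    exact M.zpow_mem hxp j
  have hxi : x ^ i ∈ H := by
    have : x ^ i = m⁻¹ * a := by rw [← hmi]; simp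
    rw [this]
    exact H.mul_mem (H.inv_mem (hH.le hm)) (hmem H hH)
  obtain ⟨u, v, huv⟩ := (Nat.prime_iff_prime_int.mp hp).irreducible.coprime_iff_not_dvd.mpr hi
  have hx1 : x = (x ^ (p : ℤ)) ^ u * (x ^ i) ^ v := by
    rw [← zpow_mul, ← zpow_mul, ← zpow_add, mul_comm _ u, mul_comm _ v, huv, zpow_one]
  rw [hx1]
  exact H.mul_mem (H.zpow_mem (hH.le hxp) u) (H.zpow_mem hxi v)

/-! ### Elements of order `p` centralizing `E`, and the case of odd `p`. -/

theorem mul_pow_of_commutator_central {G : Type*} [Group G] {a b z : G} (h : b * a = a * b * z)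
    (ha : Commute z a) (hb : Commute z b) (n : ℕ) :
    (a * b) ^ n = a ^ n * b ^ n * z ^ n.choose 2 := by
  have h1 : ∀ n : ℕ, b ^ n * a = a * b ^ n * z ^ n := by
    intro n
    induction n with
    | zero => simp
    | succ n ih =>
      calc b ^ (n + 1) * a = b * (b ^ n * a) := by rw [pow_succ', mul_assoc]
        _ = b * a * b ^ n * z ^ n := by rw [ih]; simp only [mul_assoc]
        _ = a * b * (z * b ^ n) * z ^ n := by rw [h]; simp only [mul_assoc]
        _ = a * b * (b ^ n * z) * z ^ n := by rw [(hb.pow_right n).eq]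
        _ = a * b ^ (n + 1) * z ^ (n + 1) := by
          rw [pow_succ' b, pow_succ' z]; simp only [mul_assoc]
  induction n with
  | zero => simp
  | succ n ih =>
    have h2 : Commute (z ^ n.choose 2) (a * b) := (ha.mul_right hb).pow_left _
    calc (a * b) ^ (n + 1) = a ^ n * b ^ n * (z ^ n.choose 2 * (a * b)) := by
          rw [pow_succ, ih, mul_assoc]
      _ = a ^ n * (b ^ n * a) * b * z ^ n.choose 2 := by rw [h2.eq]; simp only [mul_assoc]
      _ = a ^ n * a * b ^ n * (z ^ n * b) * z ^ n.choose 2 := by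
          rw [h1]; simp only [mul_assoc]
      _ = a ^ (n + 1) * b ^ (n + 1) * z ^ (n + 1).choose 2 := by
          rw [(hb.pow_left n).eq, Nat.choose_succ_succ' n 1, Nat.choose_one_right, pow_add z,
            pow_succ a, pow_succ b]
          simp only [mul_assoc]

namespace Subgroup.IsMaximalNormalElementaryAbelian

variable {G : Type*} [Group G] {p : ℕ} {E : Subgroup G}

theorem normal (hE : E.IsMaximalNormalElementaryAbelian p) : E.Normal := hE.prop.1

theorem mul_comm_of_mem (hE : E.IsMaximalNormalElementaryAbelian p) {x y : G} (hx : x ∈ E)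
    (hy : y ∈ E) : x * y = y * x :=
  congrArg Subtype.val (isMulCommutative_iff.mp hE.prop.2.1 ⟨x, hx⟩ ⟨y, hy⟩)

theorem pow_eq_one (hE : E.IsMaximalNormalElementaryAbelian p) {x : G} (hx : x ∈ E) :
    x ^ p = 1 := hE.prop.2.2 x hx

theorem le_centralizer (hE : E.IsMaximalNormalElementaryAbelian p) :
    E ≤ Subgroup.centralizer (E : Set G) := fun _ hx =>
  Subgroup.mem_centralizer_iff.mpr fun _ hy => hE.mul_comm_of_mem hy hx

/-- An element of order `p` centralizing `E` and central modulo `E` lies in `E`. -/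
theorem mem_of_mk_mem_center (hE : E.IsMaximalNormalElementaryAbelian p) [E.Normal] {x : G}
    (hxE : x ∈ Subgroup.centralizer (E : Set G)) (hxp : x ^ p = 1)
    (hx : (x : G ⧸ E) ∈ Subgroup.center (G ⧸ E)) : x ∈ E := by
  set H : Subgroup G := (Subgroup.zpowers (x : G ⧸ E)).comap (QuotientGroup.mk' E) with hH
  have hform : ∀ y ∈ H, ∃ i : ℤ, ∃ e ∈ E, y = x ^ i * e := by
    rintro y ⟨i, hi⟩
    refine ⟨i, (x ^ i)⁻¹ * y, QuotientGroup.eq.mp ?_, by simp⟩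
    simpa using hi
  have hcomm : ∀ e ∈ E, Commute x e := fun e he =>
    (Subgroup.mem_centralizer_iff.mp hxE e he).symm
  have hnormal : H.Normal := by
    have : (Subgroup.zpowers (x : G ⧸ E)).Normal := by
      refine ⟨fun n hn g => ?_⟩
      have : n ∈ Subgroup.center (G ⧸ E) := (Subgroup.zpowers_le.mpr hx) hn
      rwa [Subgroup.mem_center_iff.mp this g, mul_inv_cancel_right]
    exact Subgroup.Normal.comap this _
  have hEH : E ≤ H := fun e he => by
    rw [hH, Subgroup.mem_comap, QuotientGroup.mk'_apply, (QuotientGroup.eq_one_iff e).mpr he]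
    exact one_mem _
  refine hE.le_of_ge (y := H) ⟨hnormal, ?_, ?_⟩ hEH (Subgroup.mem_zpowers (x : G ⧸ E))
  · refine isMulCommutative_iff.mpr fun a b => Subtype.ext ?_
    obtain ⟨i, e, he, hi⟩ := hform a a.2
    obtain ⟨j, f, hf, hj⟩ := hform b b.2
    have h1 : Commute (x ^ i * e) (x ^ j * f) :=
      ((((Commute.refl x).zpow_right j).zpow_left i).mul_right ((hcomm f hf).zpow_left i)).mul_left
        (((hcomm e he).symm.zpow_right j).mul_right (hE.mul_comm_of_mem he hf))
    simpa [hi, hj] using h1.eq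
  · intro y hy
    obtain ⟨i, e, he, rfl⟩ := hform y hy
    rw [((hcomm e he).zpow_left i).mul_pow, hE.pow_eq_one he, mul_one, ← zpow_natCast,
      ← zpow_mul, mul_comm, zpow_mul, zpow_natCast, hxp, one_zpow]

/-- For odd `p`, the group `E` contains every element of order `p` of its centralizer. -/
theorem mem_of_two_lt [Finite G] (hp : p.Prime) (hG : IsPGroup p G)
    (hE : E.IsMaximalNormalElementaryAbelian p) (hp2 : 2 < p) {x : G}
    (hxE : x ∈ Subgroup.centralizer (E : Set G)) (hxp : x ^ p = 1) : x ∈ E := by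
  have : Fact p.Prime := ⟨hp⟩
  have := hE.normal
  have : Group.IsNilpotent (G ⧸ E) := (hG.to_quotient E).isNilpotent
  have : Group.IsNilpotent G := hG.isNilpotent
  -- Induction on the level of `xE` in the upper central series of `G ⧸ E`.
  have key : ∀ n : ℕ, ∀ x ∈ Subgroup.centralizer (E : Set G), x ^ p = 1 →
      (x : G ⧸ E) ∈ Subgroup.upperCentralSeries (G ⧸ E) n → x ∈ E := by
    intro n
    induction n with
    | zero =>
      intro x _ _ hx
      exact (QuotientGroup.eq_one_iff x).mp (by simpa using hx)
    | succ n ih =>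
      intro x hxE hxp hx
      set M : Subgroup G :=
        (Subgroup.centralizer {(x : G ⧸ E)}).comap (QuotientGroup.mk' E) with hM
      have hmem : ∀ g, g ∈ M ↔ (x : G ⧸ E) * g = g * x := fun g => by
        rw [hM, Subgroup.mem_comap, Subgroup.mem_centralizer_singleton_iff]
        exact eq_comm
      by_cases hMtop : M = ⊤
      · refine hE.mem_of_mk_mem_center hxE hxp (Subgroup.mem_center_iff.mpr fun g => ?_)
        obtain ⟨g, rfl⟩ := QuotientGroup.mk_surjective g
        exact ((hmem g).mp (hMtop ▸ Subgroup.mem_top g)).symm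
      exfalso
      -- As `g` normalizes `M`, `x` and its conjugate `y` commute modulo `E`. So `x⁻¹ * y`, one
      -- level lower, falls under the induction hypothesis, and `g` commutes with `x` modulo `E`,
      -- contradicting `g ∉ M`.
      obtain ⟨g, hgN, hgM⟩ := SetLike.exists_of_lt
        (Group.normalizerCondition_of_isNilpotent (G := G) M (lt_top_iff_ne_top.mpr hMtop))
      have hxM : x ∈ M := (hmem x).mpr rfl
      have hyM : g * x * g⁻¹ ∈ M := (Subgroup.mem_normalizer_iff.mp hgN x).mp hxM
      have hnC : (Subgroup.centralizer (E : Set G)).Normal := inferInstance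
      have hyE : g * x * g⁻¹ ∈ Subgroup.centralizer (E : Set G) := hnC.conj_mem x hxE g
      set y := g * x * g⁻¹ with hy
      have hyp : y ^ p = 1 := by rw [hy, conj_pow, hxp]; simp
      have hcomm : Commute (x : G ⧸ E) y := (hmem y).mp hyM
      set z := (x⁻¹ * y)⁻¹ * (y * x⁻¹) with hz
      have hzE : z ∈ E := by
        rw [hz, ← QuotientGroup.eq]
        exact hcomm.inv_left.eq
      have hzC : ∀ w ∈ Subgroup.centralizer (E : Set G), Commute z w := fun w hw =>
        Subgroup.mem_centralizer_iff.mp hw z hzE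
      have hu : x⁻¹ * y ∈ E := by
        refine ih _ (mul_mem (inv_mem hxE) hyE) ?_ ?_
        · rw [mul_pow_of_commutator_central (z := z) (by rw [hz]; group)
            (hzC _ (inv_mem hxE)) (hzC _ hyE), inv_pow, hxp, hyp]
          -- Oddness enters here: `p` divides `p.choose 2`, killing the commutator term.
          obtain ⟨c, hc⟩ := hp.dvd_choose_self two_ne_zero hp2
          rw [hc, pow_mul, hE.pow_eq_one hzE]
          simp
        · have h1 := Subgroup.mem_upperCentralSeries_succ_iff.mp (inv_mem hx) g
          simpa [commutatorElement_def, hy, mul_assoc] using h1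
      refine hgM ((hmem g).mpr ?_)
      have h2 : (x : G ⧸ E) = y := QuotientGroup.eq.mpr hu
      calc (x : G ⧸ E) * g = y * g := by rw [← h2]
        _ = g * x := by rw [hy]; simp
  obtain ⟨n, hn⟩ := Group.IsNilpotent.nilpotent (G ⧸ E)
  exact key n x hxE hxp (hn ▸ Subgroup.mem_top _)

end Subgroup.IsMaximalNormalElementaryAbelian

/-! ### The case `p = 2`: counting solutions of `x ^ 2 = 1`. -/

theorem MulAction.dvd_card_of_forall_dvd_card_orbit {K α : Type*} [Group K] [MulAction K α]
    [Finite α] {n : ℕ} (h : ∀ a : α, n ∣ Nat.card (MulAction.orbit K a)) : n ∣ Nat.card α := by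
  have := Fintype.ofFinite (Quotient (MulAction.orbitRel K α))
  rw [Nat.card_congr (MulAction.selfEquivSigmaOrbits K α), Nat.card_sigma]
  refine Finset.dvd_sum fun q _ => ?_
  exact h _

theorem Nat.dvd_card_of_forall_dvd_card_fiber {α β : Type*} [Finite α] [Finite β] (f : α → β)
    {n : ℕ} (h : ∀ b, n ∣ Nat.card {a // f a = b}) : n ∣ Nat.card α := by
  have := Fintype.ofFinite β
  rw [Nat.card_congr (Equiv.sigmaFiberEquiv f).symm, Nat.card_sigma]
  exact Finset.dvd_sum fun b _ => h b

/-- The action of `T × D` on `G` by `(s, d) • x = s * x * s⁻¹ * d`, where `T` is abelian. -/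
abbrev Subgroup.conjMulAction {G : Type*} [Group G] (T D : Subgroup G) (hDT : D ≤ T)
    (hT : ∀ s ∈ T, ∀ t ∈ T, s * t = t * s) : MulAction (T × D) G where
  smul sd x := sd.1 * x * (sd.1 : G)⁻¹ * sd.2
  one_smul x := by
    change ((1 : T) : G) * x * ((1 : T) : G)⁻¹ * ((1 : D) : G) = x
    simp
  mul_smul a b x := by
    change ((a.1 * b.1 : T) : G) * x * ((a.1 * b.1 : T) : G)⁻¹ * ((a.2 * b.2 : D) : G) =
      a.1 * (b.1 * x * (b.1 : G)⁻¹ * b.2) * (a.1 : G)⁻¹ * a.2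
    have h1 : (b.2 : G) * (a.1 : G)⁻¹ = (a.1 : G)⁻¹ * b.2 :=
      hT _ (hDT b.2.2) _ (T.inv_mem a.1.2)
    have h2 : (a.2 : G) * b.2 = b.2 * a.2 := hT _ (hDT a.2.2) _ (hDT b.2.2)
    simp only [Subgroup.coe_mul, mul_inv_rev, h2, mul_assoc]
    rw [← mul_assoc (b.2 : G) (a.1 : G)⁻¹, h1]
    simp only [mul_assoc]

/-- If a subgroup `C` of a finite `2`-group contains an elementary abelian subgroup `T` with
`2 ^ (2 * m) < |T|`, then the number of solutions of `x ^ 2 = 1` in `C` is divisible by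
`2 ^ (m + 1)`. -/
theorem Subgroup.two_pow_dvd_card_sq_eq_one {G : Type*} [Group G] [Finite G] (hG : IsPGroup 2 G)
    (C T : Subgroup G) (hTC : T ≤ C) (hT : ∀ s ∈ T, ∀ t ∈ T, s * t = t * s)
    (hT2 : ∀ t ∈ T, t ^ 2 = 1) {m : ℕ} (hcard : 2 ^ (2 * m) < Nat.card T) :
    2 ^ (m + 1) ∣ Nat.card {x : G | x ∈ C ∧ x ^ 2 = 1} := by
  -- Sort the solutions by `D = C_T(x)`. Each class is stable under `T × D`, whose orbits have at
  -- least `|D|` and at least `|T| / |D|` elements, hence 2-power size above `2 ^ m`.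
  refine Nat.dvd_card_of_forall_dvd_card_fiber
    (fun x : {x : G | x ∈ C ∧ x ^ 2 = 1} => T ⊓ Subgroup.centralizer {(x : G)}) fun D => ?_
  by_cases hD : D ≤ T
  swap
  · have : IsEmpty {a : {x : G | x ∈ C ∧ x ^ 2 = 1} // T ⊓ Subgroup.centralizer {(a : G)} = D} :=
      ⟨fun a => hD (a.2 ▸ inf_le_left)⟩
    simp
  let := Subgroup.conjMulAction T D hD hT
  have hsmul : ∀ (a : T × D) (x : G), a • x = a.1 * x * (a.1 : G)⁻¹ * a.2 := fun _ _ => rfl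
  have hDx : ∀ {x : G}, T ⊓ Subgroup.centralizer {x} = D → ∀ d ∈ D, d * x = x * d := by
    intro x hx d hd
    rw [← hx] at hd
    exact Subgroup.mem_centralizer_singleton_iff.mp hd.2
  let X : SubMulAction (T × D) G :=
    { carrier := {x | (x ∈ C ∧ x ^ 2 = 1) ∧ T ⊓ Subgroup.centralizer {x} = D}
      smul_mem' := by
        rintro ⟨s, d⟩ x ⟨⟨hxC, hx2⟩, hxD⟩
        simp only [hsmul]
        have hdx : (d : G) * x = x * d := hDx hxD d d.2
        have hform : (s : G) * x * (s : G)⁻¹ * d = s * (x * d) * (s : G)⁻¹ := by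
          have : (s : G)⁻¹ * d = d * (s : G)⁻¹ := hT _ (T.inv_mem s.2) _ (hD d.2)
          simp only [mul_assoc, this]
        refine ⟨⟨?_, ?_⟩, ?_⟩
        · exact C.mul_mem (C.mul_mem (C.mul_mem (hTC s.2) hxC) (C.inv_mem (hTC s.2)))
            (hTC (hD d.2))
        · have : (x * d) ^ 2 = 1 := by
            rw [(show Commute x d from hdx.symm).mul_pow, hx2, hT2 _ (hD d.2), one_mul]
          rw [hform, conj_pow, this]
          simp
        · rw [hform]
          refine Eq.trans ?_ hxD
          ext t
          simp only [Subgroup.mem_inf, Subgroup.mem_centralizer_singleton_iff]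
          refine and_congr_right fun ht => ?_
          have hts : t * s = s * t := hT _ ht _ s.2
          have hts' : (s : G)⁻¹ * t = t * (s : G)⁻¹ := hT _ (T.inv_mem s.2) _ ht
          have hdt : (d : G) * t = t * d := hT _ (hD d.2) _ ht
          have h1 : t * (s * (x * d) * (s : G)⁻¹) = s * (t * x) * (d * (s : G)⁻¹) := by
            simp only [← mul_assoc, hts]
          have h2 : s * (x * d) * (s : G)⁻¹ * t = s * (x * t) * (d * (s : G)⁻¹) := by
            simp only [mul_assoc, hts']
            rw [← mul_assoc (d : G) t, hdt, mul_assoc]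
          rw [h1, h2, mul_left_inj, mul_right_inj] }
  have e : {a : {x : G | x ∈ C ∧ x ^ 2 = 1} // T ⊓ Subgroup.centralizer {(a : G)} = D} ≃ X :=
    { toFun := fun a => ⟨a.1.1, a.1.2, a.2⟩
      invFun := fun a => ⟨⟨a.1, a.2.1⟩, a.2.2⟩
      left_inv := fun _ => rfl
      right_inv := fun _ => rfl }
  rw [Nat.card_congr e]
  refine MulAction.dvd_card_of_forall_dvd_card_orbit (K := T × D) fun x => ?_
  have hTD : IsPGroup 2 (T × D) := by
    intro a
    obtain ⟨i, hi⟩ := hG.to_subgroup T a.1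
    obtain ⟨j, hj⟩ := hG.to_subgroup D a.2
    refine ⟨i + j, Prod.ext ?_ ?_⟩
    · simp [pow_add, pow_mul, hi]
    · simp [pow_add, mul_comm (2 ^ i), pow_mul, hj]
  have : Fact (Nat.Prime 2) := ⟨Nat.prime_two⟩
  obtain ⟨n, hn⟩ := hTD.card_orbit x
  have hle1 : Nat.card D ≤ Nat.card (MulAction.orbit (T × D) x) := by
    refine Nat.card_le_card_of_injective
      (fun d : D => (⟨((1 : T), d) • x, MulAction.mem_orbit _ _⟩ : MulAction.orbit (T × D) x))
      fun d d' h => ?_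
    have h1 := congrArg (fun y : MulAction.orbit (T × D) x => ((y : X) : G)) h
    simpa [hsmul] using h1
  have hle2 : Nat.card T ≤ Nat.card (MulAction.orbit (T × D) x) * Nat.card D := by
    have h1 := Subgroup.card_le_card_mul_card_of_fibers (D.subgroupOf T)
      (fun t : T => (t, (1 : D)) • x) (MulAction.orbit (T × D) x)
      (fun t => MulAction.mem_orbit _ _) fun s t h => by
        have h1 : (s : G) * x * (s : G)⁻¹ = t * x * (t : G)⁻¹ := by
          simpa [hsmul] using congrArg (fun y : X => (y : G)) h
        have h2 : ((s⁻¹ * t : T) : G) ∈ T ⊓ Subgroup.centralizer {(x : G)} := by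
          refine ⟨(s⁻¹ * t).2, Subgroup.mem_centralizer_singleton_iff.mpr ?_⟩
          have h3 : (s : G)⁻¹ * (s * x * (s : G)⁻¹) * t = (s : G)⁻¹ * (t * x * (t : G)⁻¹) * t := by
            rw [h1]
          simpa [mul_assoc] using h3.symm
        rw [x.2.2] at h2
        exact Subgroup.mem_subgroupOf.mpr h2
    rwa [Nat.card_congr (Subgroup.subgroupOfEquivOfLe hD).toEquiv] at h1
  rw [hn] at hle1 hle2 ⊢
  refine pow_dvd_pow 2 ?_
  have h2 : 2 ^ (2 * m) < 2 ^ (n + n) := by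
    rw [pow_add]
    exact (hcard.trans_le hle2).trans_le (Nat.mul_le_mul_left _ hle1)
  have := (Nat.pow_lt_pow_iff_right one_lt_two).mp h2
  omega

namespace Subgroup.IsMaximalNormalElementaryAbelian

/-- Elementary abelian `2`-subgroups of the centralizer of `E` have order at most `|E| ^ 2`. -/
theorem card_le_sq_of_le_centralizer {G : Type*} [Group G] [Finite G] (hG : IsPGroup 2 G)
    {E : Subgroup G} (hE : E.IsMaximalNormalElementaryAbelian 2) (T : Subgroup G)
    (hTE : T ≤ Subgroup.centralizer (E : Set G)) (hT : ∀ s ∈ T, ∀ t ∈ T, s * t = t * s)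
    (hT2 : ∀ t ∈ T, t ^ 2 = 1) : Nat.card T ≤ Nat.card E ^ 2 := by
  by_contra! hlt
  have : Fact (Nat.Prime 2) := ⟨Nat.prime_two⟩
  have := hE.normal
  have hnC : (Subgroup.centralizer (E : Set G)).Normal := inferInstance
  obtain ⟨m, hm⟩ := IsPGroup.iff_card.mp (hG.to_subgroup E)
  have hdvd := Subgroup.two_pow_dvd_card_sq_eq_one hG (Subgroup.centralizer (E : Set G)) T hTE hT
    hT2 (m := m) (by rwa [mul_comm, pow_mul, ← hm])
  set J : Set G := {x : G | x ∈ Subgroup.centralizer (E : Set G) ∧ x ^ 2 = 1} with hJ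
  -- `J` is a union of cosets of `E`, so `|J| = |E| * |Y|` and `|Y|` is even. Conjugation by the
  -- 2-group `G ⧸ E` fixes `1 ∈ Y`, hence another point: a nontrivial central coset, which
  -- maximality of `E` excludes.
  let Y : SubMulAction (ConjAct (G ⧸ E)) (G ⧸ E) :=
    { carrier := {q | ∃ x ∈ J, (x : G ⧸ E) = q}
      smul_mem' := by
        rintro c _ ⟨x, ⟨hxC, hx2⟩, rfl⟩
        obtain ⟨g, hg⟩ := QuotientGroup.mk_surjective (ConjAct.ofConjAct c)
        refine ⟨g * x * g⁻¹, ⟨hnC.conj_mem x hxC g, by rw [conj_pow, hx2]; simp⟩, ?_⟩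
        rw [ConjAct.smul_def, ← hg]
        rfl }
  have hpre : (QuotientGroup.mk : G → G ⧸ E) ⁻¹' (Y : Set (G ⧸ E)) = J := by
    ext y
    constructor
    · rintro ⟨x, ⟨hxC, hx2⟩, hxy⟩
      have he : x⁻¹ * y ∈ E := QuotientGroup.eq.mp hxy
      have hy : y = x * (x⁻¹ * y) := by simp
      have hcomm : Commute x (x⁻¹ * y) := (Subgroup.mem_centralizer_iff.mp hxC _ he).symm
      rw [hy]
      exact ⟨mul_mem hxC (hE.le_centralizer he),
        by rw [hcomm.mul_pow, hx2, hE.pow_eq_one he, one_mul]⟩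
    · exact fun hy => ⟨y, hy, rfl⟩
  have hcardJ : Nat.card J = Nat.card E * Nat.card Y := by
    rw [← hpre, Nat.card_congr (QuotientGroup.preimageMkEquivSubgroupProdSet E Y), Nat.card_prod]
    rfl
  have h2 : 2 ∣ Nat.card Y := by
    rw [hcardJ, hm, pow_succ] at hdvd
    exact Nat.dvd_of_mul_dvd_mul_left (by positivity) hdvd
  have hQ : IsPGroup 2 (ConjAct (G ⧸ E)) := (hG.to_quotient E).of_equiv ConjAct.toConjAct
  have h1Y : (1 : G ⧸ E) ∈ Y := ⟨1, ⟨one_mem _, by simp⟩, rfl⟩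
  obtain ⟨⟨_, x, ⟨hxC, hx2⟩, rfl⟩, hfix, hne⟩ :=
    hQ.exists_fixed_point_of_prime_dvd_card_of_fixed_point Y h2 (a := ⟨1, h1Y⟩)
      (fun c => Subtype.ext (smul_one c))
  refine hne (Subtype.ext ?_)
  refine ((QuotientGroup.eq_one_iff x).mpr
    (hE.mem_of_mk_mem_center hxC hx2 (Subgroup.mem_center_iff.mpr fun g => ?_))).symm
  have h3 : g * (x : G ⧸ E) * g⁻¹ = x := congrArg Subtype.val (hfix (ConjAct.toConjAct g))
  exact mul_inv_eq_iff_eq_mul.mp h3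

end Subgroup.IsMaximalNormalElementaryAbelian

/-! ### Transfer to the action on `E`, and the final count. -/

open Module in
theorem AddCommGroup.card_le_pow_rank {p : ℕ} [Fact p.Prime] {V : Type*} [AddCommGroup V]
    [Finite V] (hV : ∀ x : V, p • x = 0) : Nat.card V ≤ p ^ AddGroup.rank V := by
  have : Module (ZMod p) V := AddCommGroup.zmodModule hV
  obtain ⟨S, hS, htop⟩ := AddGroup.rank_spec V
  have hspan : Submodule.span (ZMod p) (Set.range fun s : S => (s : V)) = ⊤ := by
    refine (Submodule.toAddSubgroup_injective) (top_unique (htop ▸ ?_))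
    refine (AddSubgroup.closure_le _).mpr fun x hx => ?_
    exact Submodule.subset_span ⟨⟨x, hx⟩, rfl⟩
  have hrank : finrank (ZMod p) V ≤ AddGroup.rank V := by
    have h1 := finrank_range_le_card (R := ZMod p) fun s : S => (s : V)
    rwa [Set.finrank, hspan, finrank_top, Fintype.card_coe, hS] at h1
  rw [Module.natCard_eq_pow_finrank (K := ZMod p), Nat.card_zmod]
  exact Nat.pow_le_pow_right (Fact.out : p.Prime).pos hrank

theorem AddMonoid.End.card_pow_image_le {p : ℕ} [Fact p.Prime] {V : Type*} [AddCommGroup V]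
    [Finite V] (hV : ∀ x : V, p • x = 0) (S : Set (AddMonoid.End V))
    (hS : ∀ x ∈ S, ∀ y ∈ S, Commute x y) :
    Nat.card ((fun x => x ^ p) '' S) ≤ Nat.card V := by
  have : Module (ZMod p) V := AddCommGroup.zmodModule hV
  let ρ : AddMonoid.End V →* Module.End (ZMod p) V :=
    { toFun := fun g => AddMonoidHom.toZModLinearMap p g
      map_one' := LinearMap.ext fun _ => rfl
      map_mul' := fun _ _ => LinearMap.ext fun _ => rfl }
  have hρ : Function.Injective ρ := fun g h hgh =>
    AddMonoidHom.ext fun x => LinearMap.congr_fun hgh x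
  have himage : (fun x => x ^ p) '' (ρ '' S) = ρ '' ((fun x => x ^ p) '' S) := by
    simp only [Set.image_image, map_pow]
  have h1 := Module.End.card_pow_image_le (p := p) (ρ '' S) (by
    rintro _ ⟨a, ha, rfl⟩ _ ⟨b, hb, rfl⟩
    exact (hS a ha b hb).map ρ)
  rwa [himage, Nat.card_image_of_injective hρ] at h1

theorem MulAut.card_pow_image_le {p : ℕ} (hp : p.Prime) {E : Type*} [CommGroup E] [Finite E]
    (hE : ∀ x : E, x ^ p = 1) (S : Set (MulAut E)) (hS : ∀ x ∈ S, ∀ y ∈ S, Commute x y) :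
    Nat.card ((fun x => x ^ p) '' S) ≤ Nat.card E := by
  have : Fact p.Prime := ⟨hp⟩
  let ρ : MulAut E →* AddMonoid.End (Additive E) :=
    { toFun := fun g => g.toMonoidHom.toAdditive
      map_one' := AddMonoidHom.ext fun _ => rfl
      map_mul' := fun _ _ => AddMonoidHom.ext fun _ => rfl }
  have hρ : Function.Injective ρ := fun g h hgh => MulEquiv.ext fun e =>
    congrArg Additive.toMul (DFunLike.congr_fun hgh (Additive.ofMul e))
  have himage : (fun x => x ^ p) '' (ρ '' S) = ρ '' ((fun x => x ^ p) '' S) := by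
    simp only [Set.image_image, map_pow]
  have h1 := AddMonoid.End.card_pow_image_le (p := p)
    (fun x : Additive E => congrArg Additive.ofMul (hE x.toMul)) (ρ '' S) (by
      rintro _ ⟨a, ha, rfl⟩ _ ⟨b, hb, rfl⟩
      exact (hS a ha b hb).map ρ)
  rw [himage, Nat.card_image_of_injective hρ] at h1
  exact h1

open scoped IsMulCommutative in
/-- A group of `p`-th powers of elements of an abelian group acting on an elementary abelian
group `E` induces at most `|E|` automorphisms of `E`. -/
theorem Subgroup.card_le_card_mul_card_inf_centralizer {G : Type*} [Group G] [Finite G] {p : ℕ}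
    (hp : p.Prime) {E : Subgroup G} [E.Normal] (hE : E.IsElementaryAbelian p) (A T : Subgroup G)
    (hA : ∀ a ∈ A, ∀ b ∈ A, a * b = b * a) (hTA : ∀ t ∈ T, ∃ a ∈ A, a ^ p = t) :
    Nat.card T ≤
      Nat.card E * Nat.card (T ⊓ Subgroup.centralizer (E : Set G) : Subgroup G) := by
  have := hE.1
  have : Finite (MulAut E) :=
    Finite.of_injective (fun f : MulAut E => (f : E → E)) DFunLike.coe_injective
  let ρ : G →* MulAut E := MulAut.conjNormal
  have h1 := Subgroup.card_le_card_mul_card_of_fibers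
    ((Subgroup.centralizer (E : Set G)).subgroupOf T)
    (fun t : T => ρ t) ((fun x => x ^ p) '' (ρ '' A)) (fun t => by
      obtain ⟨a, ha, hat⟩ := hTA t t.2
      exact ⟨ρ a, ⟨a, ha, rfl⟩, by rw [← hat, map_pow]⟩) fun s t hst => by
      refine Subgroup.mem_subgroupOf.mpr (Subgroup.mem_centralizer_iff.mpr fun e he => ?_)
      have h2 : (s : G) * e * (s : G)⁻¹ = t * e * (t : G)⁻¹ :=
        congrArg (fun f : MulAut E => ((f ⟨e, he⟩ : E) : G)) hst
      have h3 : (s : G)⁻¹ * (s * e * (s : G)⁻¹) * t = (s : G)⁻¹ * (t * e * (t : G)⁻¹) * t := by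
        rw [h2]
      simpa [mul_assoc] using h3
  refine h1.trans (Nat.mul_le_mul
    (MulAut.card_pow_image_le hp (fun x => Subtype.ext (hE.2 x x.2)) _ ?_) (le_of_eq ?_))
  · rintro _ ⟨a, ha, rfl⟩ _ ⟨b, hb, rfl⟩
    exact (show Commute a b from hA a ha b hb).map ρ
  · rw [← Subgroup.inf_subgroupOf_left]
    exact Nat.card_congr (Subgroup.subgroupOfEquivOfLe inf_le_left).toEquiv

open scoped IsMulCommutative in
theorem Subgroup.IsElementaryAbelian.card_le_pow_rank {G : Type*} [Group G] [Finite G] {p : ℕ}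
    (hp : p.Prime) {E : Subgroup G} (hE : E.IsElementaryAbelian p) :
    Nat.card E ≤ p ^ Group.rank E := by
  have : Fact p.Prime := ⟨hp⟩
  have := hE.1
  refine (AddCommGroup.card_le_pow_rank (V := Additive E) fun x =>
    congrArg Additive.ofMul (Subtype.ext (hE.2 _ x.toMul.2) : x.toMul ^ p = 1)).trans
      (Nat.pow_le_pow_right hp.pos ?_)
  obtain ⟨S, hS, htop⟩ := Group.rank_spec E
  rw [← hS, ← Finset.card_map Additive.ofMul.toEmbedding]
  refine AddGroup.rank_le (S := S.map Additive.ofMul.toEmbedding) ?_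
  have h1 := congrArg Subgroup.toAddSubgroup htop
  rw [Subgroup.toAddSubgroup_closure] at h1
  refine Eq.trans (congrArg _ ?_) h1
  ext x
  simp

open scoped IsMulCommutative in
/-- The rank of the Frattini subgroup of an abelian `p`-subgroup `A` is bounded by the rank of an
elementary abelian group of `p`-th powers of elements of `A`. -/
theorem Subgroup.exists_pow_rank_frattini_le_card {G : Type*} [Group G] [Finite G] {p : ℕ}
    (hp : p.Prime) (hG : IsPGroup p G) (A : Subgroup G) [IsMulCommutative A] :
    ∃ T : Subgroup G, T ≤ A ∧ (∀ t ∈ T, t ^ p = 1) ∧ (∀ t ∈ T, ∃ a ∈ A, a ^ p = t) ∧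
      p ^ Group.rank (frattini A) ≤ Nat.card T := by
  -- The witness `T` is the `p`-torsion of `Φ(A)`, viewed in `G`.
  let K : Subgroup (frattini A) := (powMonoidHom p : frattini A →* frattini A).ker
  refine ⟨(K.map (frattini A).subtype).map A.subtype, ?_, ?_, ?_, ?_⟩
  · exact Subgroup.map_subtype_le _
  · rintro _ ⟨_, ⟨x, hx, rfl⟩, rfl⟩
    have h1 : x ^ p = 1 := hx
    simpa using congrArg (fun y : frattini A => ((y : A) : G)) h1
  · rintro _ ⟨_, ⟨x, hx, rfl⟩, rfl⟩
    obtain ⟨a, ha⟩ := frattini_le_range_pow hp x.2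
    exact ⟨a, a.2, congrArg Subtype.val ha⟩
  · rw [Subgroup.card_map_of_injective A.subtype_injective,
      Subgroup.card_map_of_injective (frattini A).subtype_injective]
    exact ((hG.to_subgroup A).to_subgroup (frattini A)).pow_rank_le_card_ker_pow hp

theorem mainTheorem1 {G : Type*} [Group G] [Finite G] (p : ℕ) (hp : p.Prime) (hG : IsPGroup p G)
    (E : Subgroup G) (hE : E.IsMaximalNormalElementaryAbelian p) (k : ℕ) (hk : Group.rank E = k)
    (A : Subgroup G) (hA : IsMulCommutative A) :
    (2 < p → Group.rank (frattini A) ≤ 2 * k) ∧ (p = 2 → Group.rank (frattini A) ≤ 3 * k) := by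
  have := hE.normal
  have hEk : Nat.card E ≤ p ^ k := hk ▸ hE.prop.2.card_le_pow_rank hp
  have hAcomm : ∀ a ∈ A, ∀ b ∈ A, a * b = b * a := fun a ha b hb =>
    congrArg Subtype.val (isMulCommutative_iff.mp hA ⟨a, ha⟩ ⟨b, hb⟩)
  obtain ⟨T, hTA, hTp, hTpow, hrank⟩ := A.exists_pow_rank_frattini_le_card hp hG
  have hT := Subgroup.card_le_card_mul_card_inf_centralizer hp hE.prop.2 A T hAcomm hTpow
  constructor
  · intro hp2
    have hle : T ⊓ Subgroup.centralizer (E : Set G) ≤ E := fun x hx =>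
      hE.mem_of_two_lt hp hG hp2 hx.2 (hTp x hx.1)
    refine (Nat.pow_le_pow_iff_right hp.one_lt).mp ?_
    calc p ^ Group.rank (frattini A) ≤ Nat.card T := hrank
      _ ≤ _ := hT
      _ ≤ p ^ k * p ^ k :=
        Nat.mul_le_mul hEk ((Subgroup.card_le_of_le hle).trans hEk)
      _ = p ^ (2 * k) := by rw [← pow_add, two_mul]
  · rintro rfl
    have hle := hE.card_le_sq_of_le_centralizer hG (T ⊓ Subgroup.centralizer (E : Set G))
      inf_le_right (fun s hs t ht => hAcomm s (hTA hs.1) t (hTA ht.1)) fun t ht => hTp t ht.1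
    refine (Nat.pow_le_pow_iff_right hp.one_lt).mp ?_
    calc 2 ^ Group.rank (frattini A) ≤ Nat.card T := hrank
      _ ≤ _ := hT
      _ ≤ 2 ^ k * (2 ^ k) ^ 2 := Nat.mul_le_mul hEk (hle.trans (Nat.pow_le_pow_left hEk 2))
      _ = 2 ^ (3 * k) := by rw [← pow_mul, ← pow_add]; congr 1; ring
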